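/- Let $H$ be a separable complex Hilbert space. For orthogonal projections $P, Q$ on $H$ (bounded operators with $P^2 = P = P^*$ and $Q^2 = Q = Q^*$) such that $P - Q$ is compact, the operator $QP : P(H) \to Q(H)$ is Fredholm, and one puts $$\operatorname{ind}(P,Q) := \operatorname{ind}\bigl(QP : P(H) \to Q(H)\bigr) = \dim \ker - \dim \operatorname{coker} \in \mathbb{Z}.$$ Proposition. Let $(P_t)_{t\in[0,1]}$ and $(Q_t)_{t\in[0,1]}$ be strongly continuous paths of orthogonal projections on $H$ (that is, $t \mapsto P_t x$ and $t \mapsto Q_t x$ are continuous for every $x \in H$) such that $P_t - Q_t$ is compact for every $t \in [0,1]$ and $t \mapsto P_t - Q_t$ is continuous in the operator norm. Then, for every $t\in[0,1]$, the operator $Q_tP_t : P_t(H) \to Q_t(H)$ is Fredholm, and $\operatorname{ind}(P_t,Q_t)$ does not depend on $t$: for all $s,t \in [0,1]$, $$\operatorname{ind}(P_s,Q_s) = \operatorname{ind}(P_t,Q_t).$$ In particular $\operatorname{ind}(P_0,Q_0) = \operatorname{ind}(P_1,Q_1)$. -/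

import Mathlib

/-- For bounded operators `P`, `Q` on `H`, the operator `QP : P(H) → Q(H)`, `x ↦ Q (P x)`. -/
noncomputable def pairOperator {H : Type*} [NormedAddCommGroup H] [InnerProductSpace ℂ H]
    (P Q : H →L[ℂ] H) : P.range →L[ℂ] Q.range :=
  ((Q ∘L P) ∘L P.range.subtypeL).codRestrict Q.range (fun x => ⟨P x, rfl⟩)

/-- The index of the pair, `ind(P, Q) = ind(QP : P(H) → Q(H)) = dim ker - dim coker`. It is
meaningful when `pairOperator P Q` is a Fredholm operator. -/
noncomputable def pairIndex {H : Type*} [NormedAddCommGroup H] [InnerProductSpace ℂ H]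
    (P Q : H →L[ℂ] H) : ℤ :=
  (pairOperator P Q).toLinearMap.index

open Filter Topology

section

variable {H : Type*} [NormedAddCommGroup H] [InnerProductSpace ℂ H]

/-! Write V_t = ran P_t ∩ ker Q_t and W_t = ran Q_t ∩ ker P_t, the kernel and, up to isomorphism,
the cokernel of QP. Their dimensions may jump with t, but the index is upper semicontinuous. For t
near s, stabilise by W_s: by `eventually_mul_norm_le` the map (x, w) ↦ Q_t(x + w) on ran P_t × W_s
is injective where x ⊥ V_s, so its kernel has dimension at most dim V_s. Its index is ind(P_t, Q_t)
+ dim W_s, whence ind(P_t, Q_t) ≤ dim V_s - dim W_s = ind(P_s, Q_s). Exchanging P and Q negates the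
index, so the reverse inequality holds too; the index is locally constant and [0,1] is connected. -/

theorem IsStarProjection.apply_apply [CompleteSpace H] {P : H →L[ℂ] H} (hP : IsStarProjection P)
    (x : H) : P (P x) = P x :=
  congr($(hP.isIdempotentElem.eq) x)

theorem IsStarProjection.inner_apply_left [CompleteSpace H] {P : H →L[ℂ] H}
    (hP : IsStarProjection P) (x y : H) : inner ℂ (P x) y = inner ℂ x (P y) :=
  hP.isSelfAdjoint.isSymmetric x y

theorem IsStarProjection.norm_apply_le [CompleteSpace H] {P : H →L[ℂ] H}
    (hP : IsStarProjection P) (x : H) : ‖P x‖ ≤ ‖x‖ := by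
  simpa using P.le_of_opNorm_le (hP.norm_le) x

theorem IsStarProjection.mem_range_iff [CompleteSpace H] {P : H →L[ℂ] H}
    (hP : IsStarProjection P) {x : H} : x ∈ P.range ↔ P x = x :=
  ⟨by rintro ⟨y, rfl⟩; exact hP.apply_apply y, fun h => ⟨x, h⟩⟩

theorem IsStarProjection.isClosed_range [CompleteSpace H] {P : H →L[ℂ] H}
    (hP : IsStarProjection P) : IsClosed (P.range : Set H) :=
  ContinuousLinearMap.IsIdempotentElem.isClosed_range hP.isIdempotentElem

/-- Strong convergence of contractions is jointly continuous along convergent sequences. -/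
theorem tendsto_apply_of_norm_apply_le {P : ℕ → H →L[ℂ] H} {P₀ : H →L[ℂ] H}
    (hP : ∀ n x, ‖P n x‖ ≤ ‖x‖) (hPt : ∀ x, Tendsto (fun n => P n x) atTop (𝓝 (P₀ x)))
    {y : ℕ → H} {y₀ : H} (hy : Tendsto y atTop (𝓝 y₀)) :
    Tendsto (fun n => P n (y n)) atTop (𝓝 (P₀ y₀)) := by
  have h : Tendsto (fun n => P n (y n - y₀)) atTop (𝓝 0) :=
    squeeze_zero_norm (fun n => hP n _) (tendsto_iff_norm_sub_tendsto_zero.1 hy)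
  simpa using h.add (hPt y₀)

/-- The compact operator P - Q restricts to the identity on this closed subspace. -/
theorem finiteDimensional_range_inf_ker [CompleteSpace H] {P Q : H →L[ℂ] H}
    (hP : IsStarProjection P) (hc : IsCompactOperator (P - Q)) :
    FiniteDimensional ℂ ↥(P.range ⊓ Q.ker) := by
  have hV : ∀ x ∈ P.range ⊓ Q.ker, (P - Q) x = x := by
    rintro x ⟨h1, h2⟩
    have h2 : Q x = 0 := h2
    simp [hP.mem_range_iff.1 h1, h2]
  have h1 := IsCompactOperator.restrict (f := (P - Q : H →L[ℂ] H).toLinearMap) hc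
    (V := P.range ⊓ Q.ker) (fun x hx => (hV x hx).symm ▸ hx)
    (hP.isClosed_range.inter Q.isClosed_ker)
  refine (isCompactOperator_id_iff_finiteDimensional (𝕜 := ℂ)).1 ?_
  convert! h1 using 1
  funext x
  exact Subtype.ext (hV x x.2).symm

/-- Unit vectors `(x n, w n)` with `x n` in the range of `P n` and orthogonal to
`ran P₀ ∩ ker Q₀`, and `w n ∈ ran Q₀ ∩ ker P₀`, cannot satisfy `Q n (x n + w n) → 0`. -/
theorem false_of_tendsto_zero [CompleteSpace H] {P Q : ℕ → H →L[ℂ] H} {P₀ Q₀ : H →L[ℂ] H}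
    (hP : ∀ n, IsStarProjection (P n)) (hQ : ∀ n, IsStarProjection (Q n))
    (hP₀ : IsStarProjection P₀) (hQ₀ : IsStarProjection Q₀)
    (hPt : ∀ x, Tendsto (fun n => P n x) atTop (𝓝 (P₀ x)))
    (hQt : ∀ x, Tendsto (fun n => Q n x) atTop (𝓝 (Q₀ x)))
    (hA : Tendsto (fun n => P n - Q n) atTop (𝓝 (P₀ - Q₀)))
    (hc : IsCompactOperator (P₀ - Q₀)) {x w : ℕ → H}
    (hx : ∀ n, x n ∈ (P n).range) (hxV : ∀ n, x n ∈ (P₀.range ⊓ Q₀.ker)ᗮ)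
    (hw : ∀ n, w n ∈ Q₀.range ⊓ P₀.ker) (hn : ∀ n, ‖(x n, w n)‖ = 1)
    (hlim : Tendsto (fun n => Q n (x n + w n)) atTop (𝓝 0)) : False := by
  have hx1 : ∀ n, ‖x n‖ ≤ 1 := fun n => (norm_fst_le (x n, w n)).trans (hn n).le
  have hw1 : ∀ n, ‖w n‖ ≤ 1 := fun n => (norm_snd_le (x n, w n)).trans (hn n).le
  have : FiniteDimensional ℂ ↥(Q₀.range ⊓ P₀.ker) :=
    finiteDimensional_range_inf_ker hQ₀ (by simpa using! hc.neg)
  have : ProperSpace ↥(Q₀.range ⊓ P₀.ker) := FiniteDimensional.proper ℂ _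
  obtain ⟨w₀, -, φ, hφ, hwφ⟩ := (isCompact_closedBall (0 : ↥(Q₀.range ⊓ P₀.ker)) 1).tendsto_subseq
    (x := fun n => ⟨w n, hw n⟩) (fun n => by simpa using hw1 n)
  obtain ⟨K, hK, hK'⟩ := IsCompactOperator.image_closedBall_subset_compact
    (f := ((P₀ - Q₀) ∘L (P₀ - Q₀) : H →L[ℂ] H).toLinearMap)
    (hc.comp_clm (P₀ - Q₀)) 1
  obtain ⟨x₀, -, ψ, hψ, hxψ⟩ := hK.tendsto_subseq
    (x := fun n => (P₀ - Q₀) ((P₀ - Q₀) (x (φ n)))) (fun n => hK' ⟨x (φ n), by simpa using hx1 _, rfl⟩)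
  set θ := φ ∘ ψ with hθ_def
  have hθ : Tendsto θ atTop atTop := hφ.tendsto_atTop.comp hψ.tendsto_atTop
  have hwθ : Tendsto (fun n => w (θ n)) atTop (𝓝 (w₀ : H)) :=
    (continuous_subtype_val.tendsto _).comp (hwφ.comp hψ.tendsto_atTop)
  have hw₀Q : Q₀ w₀ = w₀ := hQ₀.mem_range_iff.1 w₀.2.1
  have hw₀P : P₀ w₀ = 0 := w₀.2.2
  have hPθ : ∀ {y : ℕ → H} {y₀ : H}, Tendsto y atTop (𝓝 y₀) →
      Tendsto (fun n => P (θ n) (y n)) atTop (𝓝 (P₀ y₀)) := fun hy =>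
    tendsto_apply_of_norm_apply_le (fun n => (hP (θ n)).norm_apply_le) (fun z => (hPt z).comp hθ) hy
  have hQθ : ∀ {y : ℕ → H} {y₀ : H}, Tendsto y atTop (𝓝 y₀) →
      Tendsto (fun n => Q (θ n) (y n)) atTop (𝓝 (Q₀ y₀)) := fun hy =>
    tendsto_apply_of_norm_apply_le (fun n => (hQ (θ n)).norm_apply_le) (fun z => (hQt z).comp hθ) hy
  have hQx : Tendsto (fun n => Q (θ n) (x (θ n))) atTop (𝓝 (-w₀)) := by
    have := (hlim.comp hθ).sub (hQθ hwθ)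
    simpa [hw₀Q, Function.comp_def] using this
  -- Norm convergence of P - Q is needed here: the x n are only bounded.
  have hsq : Tendsto (fun n => (P (θ n) - Q (θ n)) ((P (θ n) - Q (θ n)) (x (θ n))) -
      (P₀ - Q₀) ((P₀ - Q₀) (x (θ n)))) atTop (𝓝 0) := by
    have h2 := ((hA.comp hθ).mul (hA.comp hθ)).sub_const ((P₀ - Q₀) * (P₀ - Q₀))
    rw [sub_self] at h2
    refine squeeze_zero_norm (fun n => ?_) (by simpa using h2.norm)
    simpa using! ContinuousLinearMap.le_opNorm_of_le ((P (θ n) - Q (θ n)) * (P (θ n) - Q (θ n)) -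
      (P₀ - Q₀) * (P₀ - Q₀)) (hx1 (θ n))
  -- For x in ran P, x = PQx + (P - Q)²x. Here PQx tends to -P₀w₀ = 0, and compactness of (P₀ - Q₀)²
  -- makes the second term converge.
  have hxθ : Tendsto (fun n => x (θ n)) atTop (𝓝 x₀) := by
    have h := ((hPθ hQx).add hsq).add hxψ
    simp only [map_neg, hw₀P, neg_zero, zero_add, add_zero] at h
    refine h.congr fun n => ?_
    have h1 := (hP (θ n)).mem_range_iff.1 (hx (θ n))
    have h2 := (hQ (θ n)).apply_apply (x (θ n))
    simp [hθ_def] at h1 h2 ⊢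
    simp only [h1, h2]
    abel
  have hPx₀ : P₀ x₀ = x₀ := by
    refine tendsto_nhds_unique (hPθ hxθ) (hxθ.congr fun n => ?_)
    exact ((hP (θ n)).mem_range_iff.1 (hx (θ n))).symm
  have hQx₀ : Q₀ x₀ = -w₀ := tendsto_nhds_unique (hQθ hxθ) hQx
  have hw₀ : (w₀ : H) = 0 := by
    rw [← inner_self_eq_zero (𝕜 := ℂ), ← neg_eq_zero, ← inner_neg_left, ← hQx₀,
      hQ₀.inner_apply_left, hw₀Q, ← hPx₀, hP₀.inner_apply_left, hw₀P, inner_zero_right]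
  have hx₀ : x₀ = 0 := by
    have h1 : x₀ ∈ (P₀.range ⊓ Q₀.ker)ᗮ :=
      (Submodule.isClosed_orthogonal _).mem_of_tendsto hxθ (.of_forall fun n => hxV _)
    have h2 : x₀ ∈ P₀.range ⊓ Q₀.ker :=
      ⟨hP₀.mem_range_iff.2 hPx₀, by simp [hQx₀, hw₀]⟩
    exact inner_self_eq_zero.1 (Submodule.inner_right_of_mem_orthogonal h2 h1)
  have h1 : Tendsto (fun n => ‖(x (θ n), w (θ n))‖) atTop (𝓝 ‖(x₀, (w₀ : H))‖) :=
    (hxθ.prodMk_nhds hwθ).norm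
  simp [hn, hx₀, hw₀, tendsto_const_nhds_iff] at h1

/-- Near `s`, the map `(x, w) ↦ Q t (x + w)` is bounded below, uniformly in `t`, for `x` in the
range of `P t` orthogonal to `ran (P s) ∩ ker (Q s)` and `w ∈ ran (Q s) ∩ ker (P s)`. -/
theorem eventually_mul_norm_le [CompleteSpace H] {X : Type*} [TopologicalSpace X]
    [FirstCountableTopology X] {P Q : X → H →L[ℂ] H}
    (hP : ∀ t, IsStarProjection (P t)) (hQ : ∀ t, IsStarProjection (Q t))
    (hP_cont : ∀ x : H, Continuous fun t => P t x)
    (hQ_cont : ∀ x : H, Continuous fun t => Q t x)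
    (h_cont : Continuous fun t => P t - Q t) {s : X} (hc : IsCompactOperator (P s - Q s)) :
    ∃ c : ℝ, 0 < c ∧ ∀ᶠ t in 𝓝 s, ∀ x ∈ (P t).range, x ∈ ((P s).range ⊓ (Q s).ker)ᗮ →
      ∀ w ∈ (Q s).range ⊓ (P s).ker, c * ‖(x, w)‖ ≤ ‖Q t (x + w)‖ := by
  by_contra! h
  obtain ⟨U, hU⟩ := (𝓝 s).exists_antitone_basis
  have key : ∀ n : ℕ, ∃ t ∈ U n, ∃ x ∈ (P t).range, x ∈ ((P s).range ⊓ (Q s).ker)ᗮ ∧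
      ∃ w ∈ (Q s).range ⊓ (P s).ker, ‖(x, w)‖ = 1 ∧ ‖Q t (x + w)‖ ≤ 1 / ((n : ℝ) + 1) := by
    intro n
    obtain ⟨t, ⟨x, hx, hxV, w, hw, hlt⟩, ht⟩ :=
      ((h (1 / ((n : ℝ) + 1)) (by positivity)).and_eventually (hU.mem n)).exists
    have hne : ‖(x, w)‖ ≠ 0 := by
      intro h0
      rw [h0, mul_zero] at hlt
      exact absurd hlt (norm_nonneg _).not_gt
    refine ⟨t, ht, (‖(x, w)‖⁻¹ : ℂ) • x, Submodule.smul_mem _ _ hx, Submodule.smul_mem _ _ hxV,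
      (‖(x, w)‖⁻¹ : ℂ) • w, Submodule.smul_mem _ _ hw, ?_, ?_⟩
    · rw [← Prod.smul_mk, norm_smul, norm_inv, Complex.norm_real, norm_norm, inv_mul_cancel₀ hne]
    · rw [← smul_add, map_smul, norm_smul, norm_inv, Complex.norm_real, norm_norm,
        inv_mul_le_iff₀ (by positivity), mul_comm]
      exact hlt.le
  choose t ht x hx hxV w hw hn hlim using key
  have hts : Tendsto t atTop (𝓝 s) := hU.tendsto ht
  exact false_of_tendsto_zero (fun n => hP (t n)) (fun n => hQ (t n)) (hP s) (hQ s)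
    (fun x => ((hP_cont x).tendsto s).comp hts) (fun x => ((hQ_cont x).tendsto s).comp hts)
    ((h_cont.tendsto s).comp hts) hc hx hxV hw hn
    (squeeze_zero_norm hlim tendsto_one_div_add_atTop_nhds_zero_nat)

/-! ### Fredholmness and index of a single pair -/

@[simp]
theorem coe_pairOperator_apply (P Q : H →L[ℂ] H) (x : P.range) :
    (pairOperator P Q x : H) = Q (P x) := rfl

theorem adjoint_pairOperator [CompleteSpace H] {P Q : H →L[ℂ] H}
    [CompleteSpace P.range] [CompleteSpace Q.range]
    (hP : IsStarProjection P) (hQ : IsStarProjection Q) :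
    ContinuousLinearMap.adjoint (pairOperator P Q) = pairOperator Q P := by
  symm
  rw [ContinuousLinearMap.eq_adjoint_iff]
  intro x y
  simp only [Submodule.coe_inner, coe_pairOperator_apply]
  rw [hP.mem_range_iff.1 y.2, hQ.mem_range_iff.1 x.2, hP.inner_apply_left,
    hP.mem_range_iff.1 y.2, ← hQ.inner_apply_left, hQ.mem_range_iff.1 x.2]

theorem map_subtype_ker_pairOperator [CompleteSpace H] {P Q : H →L[ℂ] H}
    (hP : IsStarProjection P) :
    (pairOperator P Q).ker.map P.range.subtype = P.range ⊓ Q.ker := by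
  ext x
  simp only [Submodule.mem_map, LinearMap.mem_ker, Submodule.mem_inf]
  constructor
  · rintro ⟨y, hy, rfl⟩
    refine ⟨y.2, ?_⟩
    have := congr(($hy : H))
    simpa [hP.mem_range_iff.1 y.2] using! this
  · rintro ⟨h1, h2⟩
    refine ⟨⟨x, h1⟩, Subtype.ext ?_, rfl⟩
    simpa [hP.mem_range_iff.1 h1] using! h2

theorem finrank_ker_pairOperator [CompleteSpace H] {P Q : H →L[ℂ] H}
    (hP : IsStarProjection P) :
    Module.finrank ℂ (pairOperator P Q).ker = Module.finrank ℂ ↥(P.range ⊓ Q.ker) := by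
  rw [← map_subtype_ker_pairOperator hP]
  exact (Submodule.equivSubtypeMap _ _).finrank_eq

theorem finiteDimensional_ker_pairOperator [CompleteSpace H] {P Q : H →L[ℂ] H}
    (hP : IsStarProjection P) (hc : IsCompactOperator (P - Q)) :
    FiniteDimensional ℂ (pairOperator P Q).ker := by
  have := finiteDimensional_range_inf_ker hP hc
  rw [← map_subtype_ker_pairOperator hP] at this
  exact (Submodule.equivSubtypeMap P.range (pairOperator P Q).ker).symm.finiteDimensional

/-- Both properties can be tested on the orthogonal complement of the finite-dimensional kernel,
where the operator is bounded below. -/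
theorem isStrictMap_and_isClosed_range_pairOperator [CompleteSpace H] {P Q : H →L[ℂ] H}
    (hP : IsStarProjection P) (hQ : IsStarProjection Q) (hc : IsCompactOperator (P - Q)) :
    IsStrictMap (pairOperator P Q) ∧ IsClosed ((pairOperator P Q).range : Set Q.range) := by
  have : CompleteSpace P.range := hP.isClosed_range.completeSpace_coe
  have := finiteDimensional_ker_pairOperator hP hc
  have : (pairOperator P Q).kerᗮ.CoFG :=
    (Module.Finite.iff_fg.1 this).cofg_of_isCompl (Submodule.isCompl_orthogonal _)
  rw [(pairOperator P Q).isStrictMap_isClosed_range_iff_restrict _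
    (Submodule.isClosed_orthogonal (pairOperator P Q).ker)]
  -- A constant family over a point gives the bound for one pair; it is used with w = 0.
  obtain ⟨c, hc0, h⟩ := eventually_mul_norm_le (X := Unit) (P := fun _ => P) (Q := fun _ => Q)
    (fun _ => hP) (fun _ => hQ) (fun _ => continuous_const) (fun _ => continuous_const)
    continuous_const (s := ()) hc
  replace h := h.self_of_nhds
  have hanti : AntilipschitzWith (Real.toNNReal c⁻¹)
      ((pairOperator P Q).domRestrict (pairOperator P Q).kerᗮ) := by
    refine ContinuousLinearMap.antilipschitz_of_bound _ fun x => ?_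
    have hx : ((x : P.range) : H) ∈ (P.range ⊓ Q.ker)ᗮ := by
      rw [← map_subtype_ker_pairOperator hP, Submodule.mem_orthogonal]
      rintro _ ⟨y, hy, rfl⟩
      exact x.2 y hy
    have := h x x.1.2 hx 0 (zero_mem _)
    rw [Real.coe_toNNReal _ (by positivity), ← div_eq_inv_mul, le_div_iff₀ hc0, mul_comm]
    simpa [hP.mem_range_iff.1 x.1.2] using! this
  have hemb := hanti.isClosedEmbedding (ContinuousLinearMap.uniformContinuous _)
  exact ⟨hemb.isEmbedding.isStrictMap, by rw [LinearMap.coe_range]; exact hemb.isClosed_range⟩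

/-- The cokernel of an operator with closed range is the kernel of the adjoint. -/
noncomputable def cokerEquivKerAdjoint {E F : Type*} [NormedAddCommGroup E]
    [InnerProductSpace ℂ E] [CompleteSpace E] [NormedAddCommGroup F] [InnerProductSpace ℂ F]
    [CompleteSpace F] (T : E →L[ℂ] F) (hT : IsClosed (T.range : Set F)) :
    (F ⧸ T.range) ≃ₗ[ℂ] (ContinuousLinearMap.adjoint T).ker :=
  haveI : CompleteSpace T.range := hT.completeSpace_coe
  (Submodule.quotientEquivOfIsCompl _ _
    (Submodule.isCompl_orthogonal _)).trans
    (LinearEquiv.ofEq _ _ T.orthogonal_range)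

theorem nonempty_coker_pairOperator_equiv [CompleteSpace H] {P Q : H →L[ℂ] H}
    (hP : IsStarProjection P) (hQ : IsStarProjection Q) (hc : IsCompactOperator (P - Q)) :
    Nonempty ((Q.range ⧸ (pairOperator P Q).range) ≃ₗ[ℂ] (pairOperator Q P).ker) := by
  have : CompleteSpace P.range := hP.isClosed_range.completeSpace_coe
  have : CompleteSpace Q.range := hQ.isClosed_range.completeSpace_coe
  rw [← adjoint_pairOperator hP hQ]
  exact ⟨cokerEquivKerAdjoint _ (isStrictMap_and_isClosed_range_pairOperator hP hQ hc).2⟩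

theorem isCompactOperator_sub_comm {P Q : H →L[ℂ] H} (hc : IsCompactOperator (P - Q)) :
    IsCompactOperator (Q - P) := by
  simpa using! hc.neg

theorem isFredholm_pairOperator [CompleteSpace H] {P Q : H →L[ℂ] H}
    (hP : IsStarProjection P) (hQ : IsStarProjection Q) (hc : IsCompactOperator (P - Q)) :
    (pairOperator P Q).IsFredholm := by
  have : CompleteSpace P.range := hP.isClosed_range.completeSpace_coe
  have hker := finiteDimensional_ker_pairOperator hP hc
  have hker' := finiteDimensional_ker_pairOperator hQ (isCompactOperator_sub_comm hc)
  obtain ⟨h1, h2⟩ := isStrictMap_and_isClosed_range_pairOperator hP hQ hc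
  obtain ⟨e⟩ := nonempty_coker_pairOperator_equiv hP hQ hc
  exact ⟨h1, h2, hker, e.symm.finiteDimensional, .of_finiteDimensional _⟩

/-- This form is visibly antisymmetric in P and Q. -/
theorem pairIndex_eq [CompleteSpace H] {P Q : H →L[ℂ] H}
    (hP : IsStarProjection P) (hQ : IsStarProjection Q) (hc : IsCompactOperator (P - Q)) :
    pairIndex P Q =
      Module.finrank ℂ ↥(P.range ⊓ Q.ker) - Module.finrank ℂ ↥(Q.range ⊓ P.ker) := by
  obtain ⟨e⟩ := nonempty_coker_pairOperator_equiv hP hQ hc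
  rw [pairIndex, LinearMap.index_eq_finrank_sub, finrank_ker_pairOperator hP, e.finrank_eq,
    finrank_ker_pairOperator hQ]

/-! ### Semicontinuity of the index -/

theorem eventually_pairIndex_le [CompleteSpace H] {X : Type*} [TopologicalSpace X]
    [FirstCountableTopology X] {P Q : X → H →L[ℂ] H}
    (hP : ∀ t, IsStarProjection (P t)) (hQ : ∀ t, IsStarProjection (Q t))
    (hP_cont : ∀ x : H, Continuous fun t => P t x)
    (hQ_cont : ∀ x : H, Continuous fun t => Q t x)
    (h_compact : ∀ t, IsCompactOperator (P t - Q t))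
    (h_cont : Continuous fun t => P t - Q t) (s : X) :
    ∀ᶠ t in 𝓝 s, pairIndex (P t) (Q t) ≤ pairIndex (P s) (Q s) := by
  obtain ⟨c, hc0, h⟩ := eventually_mul_norm_le hP hQ hP_cont hQ_cont h_cont (h_compact s)
  filter_upwards [h] with t ht
  set V := (P s).range ⊓ (Q s).ker
  set W := (Q s).range ⊓ (P s).ker
  have : FiniteDimensional ℂ V := finiteDimensional_range_inf_ker (hP s) (h_compact s)
  have : FiniteDimensional ℂ W :=
    finiteDimensional_range_inf_ker (hQ s) (isCompactOperator_sub_comm (h_compact s))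
  let T : (P t).range →ₗ[ℂ] (Q t).range := (pairOperator (P t) (Q t)).toLinearMap
  let S : (P t).range × W →ₗ[ℂ] (Q t).range :=
    T.coprod ((Q t).toLinearMap.rangeRestrict ∘ₗ W.subtype)
  have hS : ∀ z, (S z : H) = Q t (z.1 + z.2) := fun z => by
    simp [S, T, (hP t).mem_range_iff.1 z.1.2]
  have hST : S ∘ₗ LinearMap.inl ℂ _ W = T := LinearMap.coprod_inl _ _
  let p : S.ker →ₗ[ℂ] V :=
    V.orthogonalProjectionOnto.toLinearMap ∘ₗ (P t).range.subtype ∘ₗ LinearMap.fst ℂ _ _ ∘ₗ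
      S.ker.subtype
  have hp : Function.Injective p := by
    rw [injective_iff_map_eq_zero]
    rintro ⟨⟨x, w⟩, hz⟩ hpz
    have hxV : (x : H) ∈ Vᗮ := Submodule.orthogonalProjectionOnto_eq_zero_iff.1 hpz
    have h0 : Q t (x + w) = 0 := by rw [← hS (x, w), LinearMap.mem_ker.1 hz]; rfl
    have h1 := ht x x.2 hxV w w.2
    rw [h0, norm_zero] at h1
    have h2 : ((x : H), (w : H)) = 0 :=
      norm_le_zero_iff.1 (nonpos_of_mul_nonpos_right h1 hc0)
    obtain ⟨hx, hw⟩ := Prod.mk_eq_zero.1 h2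
    exact Subtype.ext (Prod.ext (Subtype.ext hx) (Subtype.ext hw))
  have : FiniteDimensional ℂ S.ker := .of_injective p hp
  have hker : Module.finrank ℂ S.ker ≤ Module.finrank ℂ V :=
    LinearMap.finrank_le_finrank_of_injective hp
  have hfred := isFredholm_pairOperator (hP t) (hQ t) (h_compact t)
  -- S extends the Fredholm map T, so its cokernel is also finite-dimensional.
  have : S.range.CoFG := by
    refine Submodule.CoFG.of_le ?_ hfred.finite_coker
    change T.range ≤ S.range
    rw [← hST]
    exact LinearMap.range_comp_le_range _ _
  -- The inclusion of ran P_t has cokernel W, hence index -dim W, and T = S ∘ inl.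
  let e : (((P t).range × W) ⧸ (LinearMap.inl ℂ (P t).range W).range) ≃ₗ[ℂ] W :=
    (Submodule.quotEquivOfEq _ _ (LinearMap.range_inl ℂ (P t).range W)).trans
      (LinearMap.quotKerEquivOfSurjective _ LinearMap.snd_surjective)
  have : FiniteDimensional ℂ (((P t).range × W) ⧸ (LinearMap.inl ℂ (P t).range W).range) :=
    e.symm.finiteDimensional
  have : FiniteDimensional ℂ (LinearMap.inl ℂ (P t).range W).ker := by
    rw [LinearMap.ker_eq_bot.2 LinearMap.inl_injective]
    infer_instance
  have hinl := LinearMap.index_of_injective (f := LinearMap.inl ℂ (P t).range W)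
    LinearMap.inl_injective
  have hidx := LinearMap.index_comp (f := LinearMap.inl ℂ (P t).range W) S
  rw [hST, hinl, e.finrank_eq, LinearMap.index_eq_finrank_sub (f := S)] at hidx
  rw [pairIndex_eq (hP s) (hQ s) (h_compact s), pairIndex]
  change T.index ≤ (Module.finrank ℂ V : ℤ) - Module.finrank ℂ W
  rw [hidx]
  omega

end

theorem mainTheorem5 {H : Type*} [NormedAddCommGroup H] [InnerProductSpace ℂ H]
    [CompleteSpace H] [TopologicalSpace.SeparableSpace H]
    (P Q : unitInterval → H →L[ℂ] H)
    (hP : ∀ t, IsStarProjection (P t)) (hQ : ∀ t, IsStarProjection (Q t))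
    (hP_cont : ∀ x : H, Continuous fun t => P t x)
    (hQ_cont : ∀ x : H, Continuous fun t => Q t x)
    (h_compact : ∀ t, IsCompactOperator (P t - Q t))
    (h_cont : Continuous fun t => P t - Q t) :
    (∀ t, (pairOperator (P t) (Q t)).IsFredholm) ∧
      ∀ s t, pairIndex (P s) (Q s) = pairIndex (P t) (Q t) := by
  refine ⟨fun t => isFredholm_pairOperator (hP t) (hQ t) (h_compact t), fun s t => ?_⟩
  have h_compact' := fun t => isCompactOperator_sub_comm (h_compact t)
  have h_cont' : Continuous fun t => Q t - P t :=
    h_cont.neg.congr fun t => neg_sub _ _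
  have hloc : IsLocallyConstant fun t => pairIndex (P t) (Q t) := by
    rw [IsLocallyConstant.iff_eventually_eq]
    intro s
    filter_upwards [eventually_pairIndex_le hP hQ hP_cont hQ_cont h_compact h_cont s,
      eventually_pairIndex_le hQ hP hQ_cont hP_cont h_compact' h_cont' s] with t h1 h2
    rw [pairIndex_eq (hQ _) (hP _) (h_compact' _), pairIndex_eq (hQ _) (hP _) (h_compact' _)] at h2
    rw [pairIndex_eq (hP _) (hQ _) (h_compact _), pairIndex_eq (hP _) (hQ _) (h_compact _)] at *
    lia
  exact hloc.apply_eq_of_preconnectedSpace s t
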